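/- Let $\mathcal{I}=\mathbb{N}\times\mathbb{Z}$ and $\mathcal{J}=(\{-1\}\cup\mathbb{N})\times\mathbb{Z}$, where $\mathbb{N}=\{0,1,2,\dots\}$. Let $\mathcal{H}$ be the set of real sequences $u\in\ell^2(\mathcal{J};\mathbb{R})$ such that $u_{-1,k}=u_{0,k}$ for all $k\in\mathbb{Z}$, with $\|u\|_{\mathcal{H}}^2:=\sum_{(j,k)\in\mathcal{I}}u_{j,k}^2$, and let $\Delta_2 u_{j,k}:=u_{j,k+1}-2u_{j,k}+u_{j,k-1}$. Let $a<0$, $b\in\mathbb{R}$, $\lambda>0$, $\mu>0$ satisfy $(\lambda a)^2+(\mu b)^2\le \tfrac12$. Let $u^0\in\mathcal{H}$ and let $(u^n)_{n\in\mathbb{N}}$ be given by the stabilized Lax–Wendroff scheme: for all $n\in\mathbb{N}$ and $(j,k)\in\mathcal{I}$, $$ \begin{aligned} u_{j,k}^{n+1} = u_{j,k}^n &- \frac{\lambda a}{2}\big(u_{j+1,k}^n-u_{j-1,k}^n\big) - \frac{\mu b}{2}\big(u_{j,k+1}^n-u_{j,k-1}^n\big)\\ &+ \frac{(\lambda a)^2}{2}\big(u_{j+1,k}^n-2u_{j,k}^n+u_{j-1,k}^n\big)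 + \frac{(\mu b)^2}{2}\big(u_{j,k+1}^n-2u_{j,k}^n+u_{j,k-1}^n\big)\\ &+ \frac{\lambda a\,\mu b}{4}\big(u_{j+1,k+1}^n-u_{j+1,k-1}^n-u_{j-1,k+1}^n+u_{j-1,k-1}^n\big)\\ &- \frac{(\lambda a)^2+(\mu b)^2}{8}\big(u_{j+1,k+1}^n-2u_{j+1,k}^n+u_{j+1,k-1}^n-2u_{j,k+1}^n+4u_{j,k}^n-2u_{j,k-1}^n+u_{j-1,k+1}^n-2u_{j-1,k}^n+u_{j-1,k-1}^n\big), \end{aligned} $$ together with the Neumann extrapolation boundary condition $u_{-1,k}^n=u_{0,k}^n$ for all $n\in\mathbb{N}$, $k\in\mathbb{Z}$. Then $u^n\in\mathcal{H}$ for all $n$, and for every $n\in\mathbb{N}$, $$ \|u^{n+1}\|_{\mathcal{H}}^2-\|u^n\|_{\mathcal{H}}^2+\frac{\lambda|a|}{2}\sum_{k\in\mathbb{Z}}(u_{0,k}^n)^2+(\mu b)^2\,\frac{(\lambda a)^2+(\mu b)^2}{16}\sum_{k\in\mathbb{Z}}(\Delta_2u_{0,k}^n)^2\le 0 . $$ In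 particular, all the sums below converge, the supremum is finite, and $$ \sup_{n\in\mathbb{N}}\|u^n\|_{\mathcal{H}}^2+\frac{\lambda|a|}{2}\sum_{n\in\mathbb{N}}\sum_{k\in\mathbb{Z}}(u_{0,k}^n)^2+(\mu b)^2\,\frac{(\lambda a)^2+(\mu b)^2}{16}\sum_{n\in\mathbb{N}}\sum_{k\in\mathbb{Z}}(\Delta_2u_{0,k}^n)^2\le 2\,\|u^0\|_{\mathcal{H}}^2 . $$ -/

import Mathlib

/-! Two-dimensional Lax-Wendroff scheme with a stabilizer in the half-space `j ≥ 0`. -/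
namespace LaxWendroff

/-- The full set of cell indices `({-1} ∪ ℕ) × ℤ` (interior cells and ghost cells `j = -1`).
The interior cells are those indexed by `ℕ × ℤ`. -/
abbrev J : Type := {p : ℤ × ℤ // -1 ≤ p.1}

/-- The sequence `k ↦ u_{j,k}` for a fixed `j ≥ -1`. -/
def column (u : J → ℝ) (j : ℤ) (hj : -1 ≤ j) : ℤ → ℝ := fun k => u ⟨(j, k), hj⟩

/-- The sequence of interior values `u_{j,k}`, `(j,k) ∈ ℕ × ℤ`. -/
def interiorVal (u : J → ℝ) : ℕ × ℤ → ℝ := fun p => column u p.1 (by omega) p.2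

/-- The trace `k ↦ u_{0,k}`. -/
def bdryVal (u : J → ℝ) : ℤ → ℝ := column u 0 (by norm_num)

/-- The ghost values `k ↦ u_{-1,k}`. -/
def ghostVal (u : J → ℝ) : ℤ → ℝ := column u (-1) le_rfl

/-- The space `𝓗` of square summable sequences on all cells with `u_{-1,k} = u_{0,k}`. -/
def H : Set (J → ℝ) := {u | Memℓp u 2 ∧ ∀ k : ℤ, ghostVal u k = bdryVal u k}

/-- The squared norm of `𝓗`: only interior values are summed. -/
noncomputable def normSqH (u : J → ℝ) : ℝ := ∑' p : ℕ × ℤ, interiorVal u p ^ 2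

/-- `(D_{2,+} U)_{j,k} = U_{j,k+1} - U_{j,k}`. -/
def D2plus (U : J → ℝ) : J → ℝ := fun p => U ⟨(p.1.1, p.1.2 + 1), p.2⟩ - U p

/-- `(D_{2,-} U)_{j,k} = U_{j,k} - U_{j,k-1}`. -/
def D2minus (U : J → ℝ) : J → ℝ := fun p => U p - U ⟨(p.1.1, p.1.2 - 1), p.2⟩

/-- `Δ₂ = D_{2,+} D_{2,-}`. -/
def Lap2 (U : J → ℝ) : J → ℝ := D2plus (D2minus U)

/-- The right-hand side of the Lax-Wendroff scheme with a stabilizer at the interior cell `(j,k)`;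
`uL`, `uC`, `uR` are the columns of indices `j - 1`, `j`, `j + 1`. -/
noncomputable def lwUpdate (a b lam mu : ℝ) (u : J → ℝ) (j : ℕ) (k : ℤ) : ℝ :=
  let uL : ℤ → ℝ := column u ((j : ℤ) - 1) (by omega)
  let uC : ℤ → ℝ := column u (j : ℤ) (by omega)
  let uR : ℤ → ℝ := column u ((j : ℤ) + 1) (by omega)
  uC k
    - lam * a / 2 * (uR k - uL k) - mu * b / 2 * (uC (k + 1) - uC (k - 1))
    + (lam * a) ^ 2 / 2 * (uR k - 2 * uC k + uL k)
    + (mu * b) ^ 2 / 2 * (uC (k + 1) - 2 * uC k + uC (k - 1))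
    + lam * a * mu * b / 4 * (uR (k + 1) - uR (k - 1) - uL (k + 1) + uL (k - 1))
    - ((lam * a) ^ 2 + (mu * b) ^ 2) / 8 *
      (uR (k + 1) - 2 * uR k + uR (k - 1)
        - 2 * uC (k + 1) + 4 * uC k - 2 * uC (k - 1)
        + uL (k + 1) - 2 * uL k + uL (k - 1))

/-- `u = (u^n)_n` is produced by the scheme on the half-space with the Neumann extrapolation
condition, from an initial condition in `𝓗`. -/
structure IsNeumannScheme (a b lam mu : ℝ) (u : ℕ → J → ℝ) : Prop where
  initial : u 0 ∈ H
  step : ∀ (n : ℕ) (j : ℕ) (k : ℤ), interiorVal (u (n + 1)) (j, k) = lwUpdate a b lam mu (u n) j k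
  boundary : ∀ (n : ℕ) (k : ℤ), ghostVal (u n) k = bdryVal (u n) k

end LaxWendroff

open LaxWendroff

/-! ### Energy balance at a fixed tangential frequency. -/

namespace LaxWendroff
open Complex ComplexConjugate

/-! Put `α = lam * a`, `β = mu * b`. A Fourier transform in `k` turns the scheme, at each frequency,
into a three-point recursion in `j`. There `energy_balance` is an exact identity: energy increment
plus dissipation equals incoming minus outgoing normal flux. The CFL condition makes the dissipation
a sum of nonnegative terms, so it can be dropped away from the boundary (`energy_interior`). At `j =
0` the extrapolation gives `x = y`, and the incoming flux is `flux_self`. Half of its leading term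
`α * normSq y` pays for the trace; the other half may be outweighed by the `β` terms, and the `Δ₂`
term must be paid for as well. `coreDissipation` covers this: its minimum over `z` is explicit
(`coreDissipation_boundary`), which leaves the real inequality `boundary_scalar_inequality`.
Plancherel and summation over `j` telescope the fluxes, and the flux at infinity vanishes by square
summability (`energy_step`). Summing over `n` bounds both the supremum and the boundary sums by the
initial energy, hence the factor 2. -/

/-- The coefficient of the shift `k ↦ k + 1`, for `Y = sin² (η / 2)` and `s = sin (η / 2) cos (η / 2)`. -/
def SymbolRel (w : ℂ) (Y s : ℝ) : Prop := w = (1 - 2 * Y) + 2 * s * I ∧ s ^ 2 = Y - Y ^ 2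

/-- The Fourier transform of the scheme in the tangential variable, where `w` is the symbol of the
forward shift. -/
noncomputable def stepSymbol (α β : ℝ) (w x y z : ℂ) : ℂ :=
  y - (α / 2 : ℝ) * (z - x) - (β / 2 : ℝ) * (w * y - conj w * y)
    + (α ^ 2 / 2 : ℝ) * (z - (2 : ℝ) * y + x)
    + (β ^ 2 / 2 : ℝ) * (w * y - (2 : ℝ) * y + conj w * y)
    + (α * β / 4 : ℝ) * (w * z - conj w * z - w * x + conj w * x)
    - ((α ^ 2 + β ^ 2) / 8 : ℝ) *
      (w * z - (2 : ℝ) * z + conj w * z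
        - (2 : ℝ) * (w * y) + (4 : ℝ) * y - (2 : ℝ) * (conj w * y)
        + w * x - (2 : ℝ) * x + conj w * x)

/-- The normal energy flux between two neighbouring columns. -/
noncomputable def flux (α β Y s : ℝ) (x y : ℂ) : ℝ :=
  (β ^ 4 * Y + α * β ^ 2 * Y / 2 + α ^ 2 / 2 + 2 * α ^ 2 * β ^ 2 * Y + α ^ 3 / 2 + α ^ 3 * Y / 2
      + α ^ 4 * Y) * normSq x
    + (-β ^ 2 * Y + β ^ 4 * Y + α * β ^ 2 * Y / 2 - α ^ 2 / 2 - α ^ 2 * Y + 2 * α ^ 2 * β ^ 2 * Y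
      + α ^ 3 / 2 + α ^ 3 * Y / 2 + α ^ 4 * Y) * normSq y
    + (β ^ 2 * Y - 2 * β ^ 4 * Y + α + α * β ^ 2 * Y - 4 * α * β ^ 2 * Y ^ 2 + α ^ 2 * Y
      - 4 * α ^ 2 * β ^ 2 * Y - α ^ 3 - α ^ 3 * Y - 2 * α ^ 4 * Y) * (x.re * y.re + x.im * y.im)
    + 2 * s * (β ^ 3 * Y + α ^ 2 * β + α ^ 2 * β * Y) * (x.re * y.im - x.im * y.re)

/-- The part of the energy dissipation that is needed to control the boundary terms. -/
noncomputable def coreDissipation (α β Y s : ℝ) (x y z : ℂ) : ℝ :=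
  4 * normSq ((β ^ 2 * Y : ℝ) * y + ((α ^ 2 * (1 - Y) + β ^ 2 * Y) / 4 : ℝ) * (z - 2 * y + x))
    + 8 * (α ^ 2 + β ^ 2) *
      normSq ((β * Y / 4 : ℝ) * (z - x) + I * s * ((α / 4 : ℝ) * (z - 2 * y + x)))

/-- The remaining energy dissipation. -/
noncomputable def extraDissipation (α β Y s : ℝ) (x y z : ℂ) : ℝ :=
  4 * normSq ((α * β : ℝ) * ((z - 2 * y + x) / 4 + Y * y)
      + I * s * (((β ^ 2 - α ^ 2) / 4 : ℝ) * (z - x)))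
    + 4 * normSq ((α * β : ℝ) * ((2 * Y - 1) * (z - 2 * y + x) / 4 + Y * y)
      + I * s * (((α ^ 2 + β ^ 2) / 4 : ℝ) * (z - x)))
    + 8 * (α ^ 2 + β ^ 2) *
      normSq ((α * Y / 4 : ℝ) * (z - x) + I * s * ((β / 4 : ℝ) * (z - 2 * y + x)))
    + (1 - 2 * (α ^ 2 + β ^ 2)) * (α ^ 2 / 4 * normSq (z - 2 * y + x)
      + 4 * β ^ 2 * Y ^ 2 * normSq y + (α ^ 2 + β ^ 2) * Y * normSq (z - y))

/-- Isolates `s ^ 2`, so that it can be rewritten as `Y - Y ^ 2`; the remaining identities are then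
polynomial and linear in `s`, within reach of `ring`. -/
theorem normSq_add_I_mul (A B : ℂ) (s : ℝ) :
    normSq (A + I * s * B)
      = normSq A + s ^ 2 * normSq B + 2 * s * (A.im * B.re - A.re * B.im) := by
  simp [normSq_apply]; ring

theorem stepSymbol_eq (α β : ℝ) {w : ℂ} {Y s : ℝ} (h : SymbolRel w Y s) (x y z : ℂ) :
    stepSymbol α β w x y z =
      (y - (α / 2 : ℝ) * (z - x) + (α ^ 2 / 2 : ℝ) * (z - 2 * y + x) - (2 * β ^ 2 * Y : ℝ) * y
        + ((α ^ 2 + β ^ 2) / 2 * Y : ℝ) * (z - 2 * y + x))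
      + I * s * ((-2 * β : ℝ) * y + (α * β : ℝ) * (z - x)) := by
  have hc : conj w = (1 - 2 * Y) - 2 * s * I := by
    rw [h.1]; simp [Complex.ext_iff]
  rw [stepSymbol, hc, h.1]
  push_cast
  ring

set_option maxHeartbeats 1000000 in
/-- Local energy balance in Fourier variables. -/
theorem energy_balance (α β : ℝ) {w : ℂ} {Y s : ℝ} (h : SymbolRel w Y s) (x y z : ℂ) :
    normSq (stepSymbol α β w x y z) - normSq y
        + (coreDissipation α β Y s x y z + extraDissipation α β Y s x y z)
      = flux α β Y s x y - flux α β Y s y z := by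
  rw [stepSymbol_eq α β h]
  simp only [coreDissipation, extraDissipation, flux, normSq_add_I_mul, h.2]
  obtain ⟨x1, x2⟩ := x
  obtain ⟨y1, y2⟩ := y
  obtain ⟨z1, z2⟩ := z
  simp only [normSq_apply, add_re, add_im, sub_re, sub_im, mul_re, mul_im, ofReal_re, ofReal_im,
    re_ofNat, im_ofNat, one_re, one_im, div_ofNat_re, div_ofNat_im]
  ring

theorem flux_self (α β Y s : ℝ) (y : ℂ) :
    flux α β Y s y y = α * (1 + 2 * β ^ 2 * Y - 4 * β ^ 2 * Y ^ 2) * normSq y := by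
  simp only [flux, normSq_apply]; ring

theorem SymbolRel.nonneg {w : ℂ} {Y s : ℝ} (h : SymbolRel w Y s) : 0 ≤ Y := by
  nlinarith [h.2, sq_nonneg s, sq_nonneg Y]

theorem SymbolRel.le_one {w : ℂ} {Y s : ℝ} (h : SymbolRel w Y s) : Y ≤ 1 := by
  nlinarith [h.2, sq_nonneg s, sq_nonneg (Y - 1)]

theorem coreDissipation_nonneg (α β Y s : ℝ) (x y z : ℂ) : 0 ≤ coreDissipation α β Y s x y z := by
  have := normSq_nonneg
  unfold coreDissipation
  have h1 := this ((β ^ 2 * Y : ℝ) * y + ((α ^ 2 * (1 - Y) + β ^ 2 * Y) / 4 : ℝ) * (z - 2 * y + x))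
  have h2 := this ((β * Y / 4 : ℝ) * (z - x) + I * s * ((α / 4 : ℝ) * (z - 2 * y + x)))
  positivity

theorem extraDissipation_nonneg {α β Y : ℝ} (hc : α ^ 2 + β ^ 2 ≤ 1 / 2) (hY : 0 ≤ Y) (s : ℝ)
    (x y z : ℂ) : 0 ≤ extraDissipation α β Y s x y z := by
  have h := normSq_nonneg
  have hc' : 0 ≤ 1 - 2 * (α ^ 2 + β ^ 2) := by linarith
  unfold extraDissipation
  refine add_nonneg (add_nonneg (add_nonneg ?_ ?_) ?_) (mul_nonneg hc' ?_)
  · exact mul_nonneg (by norm_num) (h _)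
  · exact mul_nonneg (by norm_num) (h _)
  · exact mul_nonneg (by positivity) (h _)
  · have h1 := h (z - 2 * y + x)
    have h2 := h y
    have h3 := h (z - y)
    positivity

end LaxWendroff

/-! ### The boundary inequality at a fixed frequency. -/

namespace LaxWendroff
open Complex ComplexConjugate

/-- Used with `q = β ^ 2` and `t = -α`: required boundary coefficient against the minimum of the
core dissipation, with denominators cleared. -/
theorem boundary_scalar_inequality {q Y t : ℝ} (hq : 0 ≤ q) (ht : 0 ≤ t) (hY : 0 ≤ Y)
    (hY1 : Y ≤ 1) (hc : t ^ 2 + q ≤ 1 / 2) :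
    (q * (t ^ 2 + q) * Y ^ 2 + t * (4 * q * Y ^ 2 - 2 * q * Y - 1 / 2))
        * (q * Y + t ^ 2 * (1 - Y) + 2 * (t ^ 2 + q) * Y)
      ≤ 8 * (q * Y) ^ 2 * ((t ^ 2 + q) * Y) := by
  obtain ⟨x, hx⟩ : ∃ x, x = q * Y := ⟨_, rfl⟩
  obtain ⟨A, hA⟩ : ∃ A, A = t ^ 2 := ⟨_, rfl⟩
  have hx0 : 0 ≤ x := hx ▸ mul_nonneg hq hY
  have hA0 : 0 ≤ A := hA ▸ sq_nonneg t
  have hxA : x + A * Y ≤ Y / 2 := by rw [hx, hA]; nlinarith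
  have hAY : A * Y ≤ A := by nlinarith
  have hAY0 : 0 ≤ A * Y := mul_nonneg hA0 hY
  have hxA1 : x ≤ 1 / 2 - A := by nlinarith
  set P := x + A * Y with hP
  have hP0 : 0 ≤ P := by positivity
  have hP2 : P ≤ 1 / 2 := by linarith
  have hK0 : 0 ≤ 3 * x + A * (1 + Y) := by positivity
  suffices h : (x * P + t * (2 * x * (2 * Y - 1) - 1 / 2)) * (3 * x + A * (1 + Y))
      ≤ 8 * x ^ 2 * P by
    rw [hP, hx, hA] at h
    convert h using 1 <;> ring
  have htA : 7 / 5 * A ≤ t := by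
    have : t ≤ 5 / 7 := by nlinarith
    rw [hA]; nlinarith
  -- The split is on the sign of the factor of `t`. If it is nonnegative, `x` and `Y` are bounded
  -- below and everything reduces to a quadratic in `x` with negative discriminant (vertex `15 /
  -- 56`).
  rcases le_total (1 / 2) (2 * x * (2 * Y - 1)) with hcase | hcase
  · have hx4 : 1 / 4 ≤ x := by nlinarith
    have hY2 : 1 / 2 ≤ Y := by linarith
    have hR : x * P + t * (2 * x * (2 * Y - 1) - 1 / 2)
        ≤ x * P + (A + 1 / 4) * (2 * x - 1 / 2) := by
      have h1 : t ≤ A + 1 / 4 := by rw [hA]; nlinarith [sq_nonneg (t - 1 / 2)]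
      have h2 : 2 * x * (2 * Y - 1) - 1 / 2 ≤ 2 * x - 1 / 2 := by nlinarith
      have := mul_le_mul h1 h2 (by linarith) (by linarith)
      linarith
    have hK : 3 * x + A * (1 + Y) ≤ 3 * P := by rw [hP]; nlinarith
    have hR3 : 3 * (x * P + (A + 1 / 4) * (2 * x - 1 / 2)) ≤ 8 * x ^ 2 := by
      have h1 : x * P ≤ x * (1 / 2) := mul_le_mul_of_nonneg_left hP2 hx0
      have h2 : (A + 1 / 4) * (2 * x - 1 / 2) ≤ (3 / 4 - x) * (2 * x - 1 / 2) :=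
        mul_le_mul_of_nonneg_right (by linarith) (by linarith)
      nlinarith [sq_nonneg (x - 15 / 56)]
    have hRn : 0 ≤ x * P + (A + 1 / 4) * (2 * x - 1 / 2) :=
      add_nonneg (mul_nonneg hx0 hP0) (mul_nonneg (by linarith) (by linarith))
    calc _ ≤ (x * P + (A + 1 / 4) * (2 * x - 1 / 2)) * (3 * P) :=
          mul_le_mul hR hK hK0 hRn
      _ = (3 * (x * P + (A + 1 / 4) * (2 * x - 1 / 2))) * P := by ring
      _ ≤ _ := mul_le_mul_of_nonneg_right hR3 hP0
  -- The `t` term now helps. Either the multiplier is at most `8 * x` and that term can be dropped,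
  -- or `x` is small compared with `A` and that term dominates.
  · rcases le_total (A * (1 + Y)) (5 * x) with h5 | h5
    · have hR : x * P + t * (2 * x * (2 * Y - 1) - 1 / 2) ≤ x * P := by nlinarith
      calc _ ≤ (x * P) * (3 * x + A * (1 + Y)) := mul_le_mul_of_nonneg_right hR hK0
        _ ≤ (x * P) * (8 * x) :=
          mul_le_mul_of_nonneg_left (by linarith) (mul_nonneg hx0 hP0)
        _ = _ := by ring
    · have hx7 : x ≤ 1 / 7 := by nlinarith
      have hx25 : x ≤ 2 / 5 * A := by nlinarith
      have h1 : 3 / 14 ≤ 1 / 2 - 2 * x * (2 * Y - 1) := by nlinarith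
      have h2 : 7 / 5 * A * (3 / 14) ≤ t * (1 / 2 - 2 * x * (2 * Y - 1)) :=
        mul_le_mul htA h1 (by norm_num) ht
      have h3 : x * P ≤ 2 / 5 * A * (1 / 2) := mul_le_mul hx25 hP2 hP0 (by linarith)
      have hR : x * P + t * (2 * x * (2 * Y - 1) - 1 / 2) ≤ 0 := by nlinarith
      exact (mul_nonpos_of_nonpos_of_nonneg hR hK0).trans (by positivity)

/-- For `x = y` the core is a quadratic form in `y` and `z - y`; this completes the square in `z -
y`. -/
theorem coreDissipation_boundary (α β : ℝ) {Y s : ℝ} (hs : s ^ 2 = Y - Y ^ 2) (y z : ℂ) :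
    (β ^ 2 * Y + α ^ 2 * (1 - Y) + 2 * (α ^ 2 + β ^ 2) * Y) * coreDissipation α β Y s y y z
      = 8 * (β ^ 2 * Y) ^ 2 * ((α ^ 2 + β ^ 2) * Y) * normSq y
        + (β ^ 2 * Y + α ^ 2 * (1 - Y)) * normSq ((2 * β ^ 2 * Y : ℝ) * y
          + ((β ^ 2 * Y + α ^ 2 * (1 - Y) + 2 * (α ^ 2 + β ^ 2) * Y) / 2 : ℝ) * (z - y)) := by
  simp only [coreDissipation, normSq_add_I_mul, hs]
  obtain ⟨y1, y2⟩ := y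
  obtain ⟨z1, z2⟩ := z
  simp only [normSq_apply, add_re, add_im, sub_re, sub_im, mul_re, mul_im, ofReal_re, ofReal_im,
    re_ofNat, im_ofNat]
  ring

theorem le_coreDissipation_boundary {α β Y s : ℝ} (hα : α ≤ 0) (hc : α ^ 2 + β ^ 2 ≤ 1 / 2)
    (hY : 0 ≤ Y) (hY1 : Y ≤ 1) (hs : s ^ 2 = Y - Y ^ 2) (y z : ℂ) :
    (β ^ 2 * (α ^ 2 + β ^ 2) * Y ^ 2
        - α * (4 * β ^ 2 * Y ^ 2 - 2 * β ^ 2 * Y - 1 / 2)) * normSq y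
      ≤ coreDissipation α β Y s y y z := by
  have hscal := boundary_scalar_inequality (sq_nonneg β) (neg_nonneg.2 hα) hY hY1
    (by simpa using hc)
  rw [neg_sq] at hscal
  set R := β ^ 2 * (α ^ 2 + β ^ 2) * Y ^ 2 - α * (4 * β ^ 2 * Y ^ 2 - 2 * β ^ 2 * Y - 1 / 2) with hR
  have hD := coreDissipation_nonneg α β Y s y y z
  have hy := normSq_nonneg y
  rcases le_or_gt R 0 with h0 | h0
  · exact (mul_nonpos_of_nonpos_of_nonneg h0 hy).trans hD
  have hκ : 0 ≤ β ^ 2 * Y + α ^ 2 * (1 - Y) :=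
    add_nonneg (by positivity) (mul_nonneg (sq_nonneg _) (by linarith))
  have hcY : 0 ≤ 2 * (α ^ 2 + β ^ 2) * Y := by positivity
  -- If the multiplier vanished, then `β ^ 2 * Y = 0` and `R = α / 2 ≤ 0`, against `h0`.
  have hm : 0 < β ^ 2 * Y + α ^ 2 * (1 - Y) + 2 * (α ^ 2 + β ^ 2) * Y := by
    refine lt_of_le_of_ne (by linarith) fun h => ?_
    have hA : 0 ≤ α ^ 2 * (1 - Y) := mul_nonneg (sq_nonneg _) (by linarith)
    have hB : 0 ≤ β ^ 2 * Y := by positivity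
    have h1 : β ^ 2 * Y = 0 := by linarith
    have : R = α / 2 := by
      rw [hR]
      linear_combination ((α ^ 2 + β ^ 2) * Y - α * (4 * Y - 2)) * h1
    linarith
  refine le_of_mul_le_mul_left ?_ hm
  rw [coreDissipation_boundary α β hs]
  have hn := mul_nonneg hκ (normSq_nonneg ((2 * β ^ 2 * Y : ℝ) * y
    + ((β ^ 2 * Y + α ^ 2 * (1 - Y) + 2 * (α ^ 2 + β ^ 2) * Y) / 2 : ℝ) * (z - y)))
  have := mul_le_mul_of_nonneg_right hscal hy
  rw [hR]
  linarith

theorem energy_interior {α β : ℝ} (hc : α ^ 2 + β ^ 2 ≤ 1 / 2) {w : ℂ} {Y s : ℝ}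
    (h : SymbolRel w Y s) (x y z : ℂ) :
    normSq (stepSymbol α β w x y z) ≤ normSq y + flux α β Y s x y - flux α β Y s y z := by
  linarith [energy_balance α β h x y z, coreDissipation_nonneg α β Y s x y z,
    extraDissipation_nonneg hc h.nonneg s x y z]

theorem energy_boundary {α β : ℝ} (hα : α ≤ 0) (hc : α ^ 2 + β ^ 2 ≤ 1 / 2) {w : ℂ} {Y s : ℝ}
    (h : SymbolRel w Y s) (y z : ℂ) :
    normSq (stepSymbol α β w y y z) + -α / 2 * normSq y
        + β ^ 2 * (α ^ 2 + β ^ 2) * (Y ^ 2 * normSq y)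
      ≤ normSq y - flux α β Y s y z := by
  linarith [energy_balance α β h y y z, flux_self α β Y s y,
    le_coreDissipation_boundary hα hc h.nonneg h.le_one h.2 y z,
    extraDissipation_nonneg hc h.nonneg s y y z]

end LaxWendroff

/-! ### Fourier series in the tangential variable. -/

namespace LaxWendroff
open Complex ComplexConjugate MeasureTheory AddCircle

/-- The square integrable function `f` on the circle has the Fourier coefficients `x`. -/
def HasHat (f : UnitAddCircle → ℂ) (x : ℤ → ℝ) : Prop :=
  MemLp f 2 haarAddCircle ∧ ∀ k, fourierCoeff f k = x k

theorem exists_hasHat {x : ℤ → ℝ} (hx : Summable fun k => x k ^ 2) : ∃ f, HasHat f x := by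
  have hx' : Memℓp (fun k => (x k : ℂ)) 2 := by
    refine memℓp_gen ?_
    simpa using hx
  let v : lp (fun _ : ℤ => ℂ) 2 := ⟨_, hx'⟩
  refine ⟨fourierBasis.repr.symm v, Lp.memLp _, fun k => ?_⟩
  rw [← fourierBasis_repr]
  simp [v]

theorem norm_fourier_apply (m : ℤ) (t : UnitAddCircle) : ‖fourier m t‖ = 1 := by
  rw [fourier_apply]; exact Circle.norm_coe _

namespace HasHat

variable {f g : UnitAddCircle → ℂ} {x y : ℤ → ℝ}

theorem integrable (hf : HasHat f x) : Integrable f haarAddCircle :=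
  hf.1.integrable (by norm_num)

theorem add (hf : HasHat f x) (hg : HasHat g y) :
    HasHat (fun t => f t + g t) (fun k => x k + y k) :=
  ⟨hf.1.add hg.1, fun k => by
    have := fourierCoeff.add hf.integrable hg.integrable
    have := congrFun this k
    simp only [Pi.add_apply, hf.2, hg.2] at this
    push_cast
    exact this⟩

theorem const_mul (hf : HasHat f x) (c : ℝ) :
    HasHat (fun t => (c : ℂ) * f t) (fun k => c * x k) :=
  ⟨hf.1.const_mul _, fun k => by
    rw [fourierCoeff.const_mul, hf.2]; push_cast; rfl⟩

theorem sub (hf : HasHat f x) (hg : HasHat g y) :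
    HasHat (fun t => f t - g t) (fun k => x k - y k) := by
  convert hf.add (hg.const_mul (-1)) using 2 <;> simp [sub_eq_add_neg]

theorem fourier_mul (hf : HasHat f x) (m : ℤ) :
    HasHat (fun t => fourier m t * f t) (fun k => x (k - m)) := by
  refine ⟨?_, fun k => ?_⟩
  · refine hf.1.of_le ((map_continuous (fourier m)).aestronglyMeasurable.mul hf.1.1) ?_
    refine Filter.Eventually.of_forall fun t => ?_
    simp only [norm_mul, norm_fourier_apply, one_mul, le_refl]
  · rw [← hf.2, fourierCoeff, fourierCoeff]
    congr 1
    ext t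
    rw [show -(k - m) = -k + m by ring, fourier_add]
    simp [mul_assoc]

theorem hasSum_sq (hf : HasHat f x) :
    HasSum (fun k => x k ^ 2) (∫ t, normSq (f t) ∂haarAddCircle) := by
  have h := hasSum_sq_fourierCoeff (hf.1.toLp f)
  have h1 : ∀ k, fourierCoeff (hf.1.toLp f) k = x k := fun k => by
    rw [← hf.2, fourierCoeff_congr_ae hf.1.coeFn_toLp]
  have h2 : ∫ t, ‖hf.1.toLp f t‖ ^ 2 ∂haarAddCircle = ∫ t, normSq (f t) ∂haarAddCircle := by
    refine integral_congr_ae ?_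
    filter_upwards [hf.1.coeFn_toLp] with t ht
    rw [ht, normSq_eq_norm_sq]
  rw [h2] at h
  simpa [h1] using h

theorem integrable_normSq (hf : HasHat f x) :
    Integrable (fun t => normSq (f t)) haarAddCircle := by
  have := hf.1.integrable_norm_pow (by norm_num)
  simpa [normSq_eq_norm_sq] using this

end HasHat

/-- The symbol of the forward shift. -/
noncomputable def shiftSymbol (t : UnitAddCircle) : ℂ := fourier (-1) t

/-- The symbol of `-Δ₂ / 4`. -/
noncomputable def lapSymbol (t : UnitAddCircle) : ℝ := (1 - (shiftSymbol t).re) / 2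

/-- The symbol of the centered difference is `2 * I * diffSymbol`. -/
noncomputable def diffSymbol (t : UnitAddCircle) : ℝ := (shiftSymbol t).im / 2

theorem continuous_shiftSymbol : Continuous shiftSymbol := map_continuous (fourier (-1))

theorem conj_shiftSymbol (t : UnitAddCircle) : conj (shiftSymbol t) = fourier 1 t := by
  rw [shiftSymbol, ← fourier_neg, neg_neg]

theorem symbolRel (t : UnitAddCircle) :
    SymbolRel (shiftSymbol t) (lapSymbol t) (diffSymbol t) := by
  have h : normSq (shiftSymbol t) = 1 := by
    rw [normSq_eq_norm_sq, shiftSymbol, norm_fourier_apply, one_pow]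
  rw [normSq_apply] at h
  refine ⟨?_, ?_⟩
  · apply Complex.ext <;> simp [lapSymbol, diffSymbol] <;> ring
  · simp only [lapSymbol, diffSymbol]; linarith

theorem HasHat.shift {f : UnitAddCircle → ℂ} {x : ℤ → ℝ} (hf : HasHat f x) :
    HasHat (fun t => shiftSymbol t * f t) (fun k => x (k + 1)) := by
  simpa only [sub_neg_eq_add, shiftSymbol] using hf.fourier_mul (-1)

theorem HasHat.shift_back {f : UnitAddCircle → ℂ} {x : ℤ → ℝ} (hf : HasHat f x) :
    HasHat (fun t => conj (shiftSymbol t) * f t) (fun k => x (k - 1)) := by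
  simpa [conj_shiftSymbol] using hf.fourier_mul 1

/-- The scheme in terms of three consecutive columns. -/
noncomputable def columnStep (α β : ℝ) (x y z : ℤ → ℝ) (k : ℤ) : ℝ :=
  y k - α / 2 * (z k - x k) - β / 2 * (y (k + 1) - y (k - 1))
    + α ^ 2 / 2 * (z k - 2 * y k + x k)
    + β ^ 2 / 2 * (y (k + 1) - 2 * y k + y (k - 1))
    + α * β / 4 * (z (k + 1) - z (k - 1) - x (k + 1) + x (k - 1))
    - (α ^ 2 + β ^ 2) / 8 *
      (z (k + 1) - 2 * z k + z (k - 1)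
        - 2 * y (k + 1) + 4 * y k - 2 * y (k - 1)
        + x (k + 1) - 2 * x k + x (k - 1))

/-- The combinators are nested as in `stepSymbol`, whose coefficients are real casts, so the term
checks by unfolding. -/
theorem HasHat.columnStep {f g h : UnitAddCircle → ℂ} {x y z : ℤ → ℝ} (hf : HasHat f x)
    (hg : HasHat g y) (hh : HasHat h z) (α β : ℝ) :
    HasHat (fun t => stepSymbol α β (shiftSymbol t) (f t) (g t) (h t)) (columnStep α β x y z) :=
  (((((hg.sub ((hh.sub hf).const_mul _)).sub ((hg.shift.sub hg.shift_back).const_mul _)).add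
    (((hh.sub (hg.const_mul _)).add hf).const_mul _)).add
    (((hg.shift.sub (hg.const_mul _)).add hg.shift_back).const_mul _)).add
    ((((hh.shift.sub hh.shift_back).sub hf.shift).add hf.shift_back).const_mul _)).sub
    (((((((((hh.shift.sub (hh.const_mul _)).add hh.shift_back).sub (hg.shift.const_mul _)).add
      (hg.const_mul _)).sub (hg.shift_back.const_mul _)).add hf.shift).sub
      (hf.const_mul _)).add hf.shift_back).const_mul _)

theorem HasHat.hasSum_sq_lap {f : UnitAddCircle → ℂ} {x : ℤ → ℝ} (hf : HasHat f x) :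
    HasSum (fun k => (x (k + 1) - 2 * x k + x (k - 1)) ^ 2)
      (16 * ∫ t, lapSymbol t ^ 2 * normSq (f t) ∂haarAddCircle) := by
  have h := ((hf.shift.sub (hf.const_mul 2)).add hf.shift_back).hasSum_sq
  convert h using 1
  rw [← integral_const_mul]
  congr 1
  ext t
  have : shiftSymbol t * f t - (2 : ℝ) * f t + conj (shiftSymbol t) * f t
      = (-4 * lapSymbol t : ℝ) * f t := by
    have h2 := Complex.add_conj (shiftSymbol t)
    push_cast at h2
    simp only [lapSymbol]
    push_cast
    linear_combination (f t) * h2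
  rw [this, normSq_mul, normSq_ofReal]
  ring

theorem continuous_lapSymbol : Continuous lapSymbol :=
  (continuous_const.sub (continuous_re.comp continuous_shiftSymbol)).div_const _

theorem continuous_diffSymbol : Continuous diffSymbol :=
  (continuous_im.comp continuous_shiftSymbol).div_const _

/-- The coefficients of this quadratic form are continuous on the compact circle. The uniform bound
gives both integrability of the flux and its decay in `j`. -/
theorem exists_abs_flux_le (α β : ℝ) : ∃ C : ℝ, ∀ (t : UnitAddCircle) (x y : ℂ),
    |flux α β (lapSymbol t) (diffSymbol t) x y| ≤ C * (normSq x + normSq y) := by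
  have hb : ∀ φ : ℝ × ℝ → ℝ, Continuous φ →
      ∃ C : ℝ, ∀ t, |φ (lapSymbol t, diffSymbol t)| ≤ C := fun φ hφ => by
    obtain ⟨C, hC⟩ := (isCompact_univ (X := UnitAddCircle)).exists_bound_of_continuousOn
      (hφ.comp (continuous_lapSymbol.prodMk continuous_diffSymbol)).continuousOn
    exact ⟨C, fun t => hC t trivial⟩
  obtain ⟨A, hA⟩ := hb (fun p => β ^ 4 * p.1 + α * β ^ 2 * p.1 / 2 + α ^ 2 / 2
    + 2 * α ^ 2 * β ^ 2 * p.1 + α ^ 3 / 2 + α ^ 3 * p.1 / 2 + α ^ 4 * p.1) (by fun_prop)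
  obtain ⟨B, hB⟩ := hb (fun p => -β ^ 2 * p.1 + β ^ 4 * p.1 + α * β ^ 2 * p.1 / 2 - α ^ 2 / 2
    - α ^ 2 * p.1 + 2 * α ^ 2 * β ^ 2 * p.1 + α ^ 3 / 2 + α ^ 3 * p.1 / 2 + α ^ 4 * p.1)
    (by fun_prop)
  obtain ⟨C, hC⟩ := hb (fun p => β ^ 2 * p.1 - 2 * β ^ 4 * p.1 + α + α * β ^ 2 * p.1
    - 4 * α * β ^ 2 * p.1 ^ 2 + α ^ 2 * p.1 - 4 * α ^ 2 * β ^ 2 * p.1 - α ^ 3 - α ^ 3 * p.1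
    - 2 * α ^ 4 * p.1) (by fun_prop)
  obtain ⟨D, hD⟩ := hb (fun p => 2 * p.2 * (β ^ 3 * p.1 + α ^ 2 * β + α ^ 2 * β * p.1))
    (by fun_prop)
  refine ⟨A + B + C + D, fun t x y => ?_⟩
  have hx := normSq_nonneg x
  have hy := normSq_nonneg y
  have h1 : |x.re * y.re + x.im * y.im| ≤ normSq x + normSq y := by
    rw [normSq_apply, normSq_apply, abs_le]
    constructor <;> nlinarith [sq_nonneg (x.re + y.re), sq_nonneg (x.im + y.im),
      sq_nonneg (x.re - y.re), sq_nonneg (x.im - y.im)]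
  have h2 : |x.re * y.im - x.im * y.re| ≤ normSq x + normSq y := by
    rw [normSq_apply, normSq_apply, abs_le]
    constructor <;> nlinarith [sq_nonneg (x.re + y.im), sq_nonneg (x.im + y.re),
      sq_nonneg (x.re - y.im), sq_nonneg (x.im - y.re)]
  have hm : ∀ {a b c d : ℝ}, |a| ≤ c → |b| ≤ d → |a * b| ≤ c * d := fun ha hb => by
    rw [abs_mul]; exact mul_le_mul ha hb (abs_nonneg _) ((abs_nonneg _).trans ha)
  have hnx : |normSq x| ≤ normSq x + normSq y := by rw [abs_of_nonneg hx]; linarith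
  have hny : |normSq y| ≤ normSq x + normSq y := by rw [abs_of_nonneg hy]; linarith
  unfold flux
  refine (abs_add_le _ _).trans ?_
  rw [add_mul (A + B + C), add_mul (A + B), add_mul A]
  refine add_le_add ((abs_add_le _ _).trans ?_) (hm (hD t) h2)
  refine add_le_add ((abs_add_le _ _).trans ?_) (hm (hC t) h1)
  exact add_le_add (hm (hA t) hnx) (hm (hB t) hny)

theorem integrable_flux (α β : ℝ) {f g : UnitAddCircle → ℂ} {x y : ℤ → ℝ} (hf : HasHat f x)
    (hg : HasHat g y) :
    Integrable (fun t => flux α β (lapSymbol t) (diffSymbol t) (f t) (g t)) haarAddCircle := by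
  obtain ⟨C, hC⟩ := exists_abs_flux_le α β
  refine ((hf.integrable_normSq.add hg.integrable_normSq).const_mul C).mono' ?_
    (Filter.Eventually.of_forall fun t => hC t _ _)
  have hcont : Continuous fun p : (ℝ × ℝ) × (ℂ × ℂ) => flux α β p.1.1 p.1.2 p.2.1 p.2.2 := by
    unfold flux
    have := continuous_normSq
    fun_prop
  exact hcont.comp_aestronglyMeasurable
    (f := fun t => ((lapSymbol t, diffSymbol t), (f t, g t)))
    ((continuous_lapSymbol.prodMk continuous_diffSymbol).aestronglyMeasurable.prodMk
      (hf.1.1.prodMk hg.1.1))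

end LaxWendroff

/-! ### Plancherel and summation over the columns. -/

namespace LaxWendroff
open Complex ComplexConjugate MeasureTheory AddCircle Filter Topology

/-- The total energy flux between two columns. -/
noncomputable def totalFlux (α β : ℝ) (f g : UnitAddCircle → ℂ) : ℝ :=
  ∫ t, flux α β (lapSymbol t) (diffSymbol t) (f t) (g t) ∂haarAddCircle

section

variable {α β : ℝ} {f g h : UnitAddCircle → ℂ} {x y z : ℤ → ℝ}

theorem exists_abs_totalFlux_le (α β : ℝ) : ∃ C : ℝ, ∀ {f g : UnitAddCircle → ℂ} {x y : ℤ → ℝ},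
    HasHat f x → HasHat g y →
      |totalFlux α β f g| ≤ C * (∑' k, x k ^ 2 + ∑' k, y k ^ 2) := by
  obtain ⟨C, hC⟩ := exists_abs_flux_le α β
  refine ⟨C, fun {f g x y} hf hg => ?_⟩
  rw [hf.hasSum_sq.tsum_eq, hg.hasSum_sq.tsum_eq,
    ← integral_add hf.integrable_normSq hg.integrable_normSq, ← integral_const_mul]
  refine abs_integral_le_integral_abs.trans ?_
  exact integral_mono (integrable_flux α β hf hg).abs
    ((hf.integrable_normSq.add hg.integrable_normSq).const_mul C) fun t => hC t _ _

theorem column_energy_interior (hc : α ^ 2 + β ^ 2 ≤ 1 / 2) (hf : HasHat f x) (hg : HasHat g y)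
    (hh : HasHat h z) :
    ∑' k, columnStep α β x y z k ^ 2
      ≤ ∑' k, y k ^ 2 + totalFlux α β f g - totalFlux α β g h := by
  have hs := hf.columnStep hg hh α β
  have i1 := integrable_flux α β hf hg
  have i2 := integrable_flux α β hg hh
  rw [hs.hasSum_sq.tsum_eq, hg.hasSum_sq.tsum_eq, totalFlux, totalFlux,
    ← integral_add' hg.integrable_normSq i1, ← integral_sub' (hg.integrable_normSq.add i1) i2]
  exact integral_mono hs.integrable_normSq ((hg.integrable_normSq.add i1).sub i2)
    fun t => energy_interior hc (symbolRel t) _ _ _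

theorem integrable_lapSymbol_sq_mul (hg : HasHat g y) :
    Integrable (fun t => lapSymbol t ^ 2 * normSq (g t)) haarAddCircle := by
  refine hg.integrable_normSq.mono' ((continuous_lapSymbol.pow 2).aestronglyMeasurable.mul
    hg.integrable_normSq.1) (Eventually.of_forall fun t => ?_)
  have h0 := (symbolRel t).nonneg
  have h1 := (symbolRel t).le_one
  have hn := normSq_nonneg (g t)
  rw [Real.norm_eq_abs, abs_of_nonneg (by positivity)]
  exact mul_le_of_le_one_left hn (pow_le_one₀ h0 h1)

theorem column_energy_boundary (hα : α ≤ 0) (hc : α ^ 2 + β ^ 2 ≤ 1 / 2) (hg : HasHat g y)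
    (hh : HasHat h z) :
    ∑' k, columnStep α β y y z k ^ 2 + -α / 2 * ∑' k, y k ^ 2
        + β ^ 2 * ((α ^ 2 + β ^ 2) / 16) * ∑' k, (y (k + 1) - 2 * y k + y (k - 1)) ^ 2
      ≤ ∑' k, y k ^ 2 - totalFlux α β g h := by
  have hs := hg.columnStep hg hh α β
  have i2 := integrable_flux α β hg hh
  have i3 := integrable_lapSymbol_sq_mul hg
  have key := integral_mono
    ((hs.integrable_normSq.add (hg.integrable_normSq.const_mul (-α / 2))).add
      (i3.const_mul (β ^ 2 * (α ^ 2 + β ^ 2))))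
    (hg.integrable_normSq.sub i2) fun t => energy_boundary hα hc (symbolRel t) _ _
  rw [integral_add' (hs.integrable_normSq.add (hg.integrable_normSq.const_mul (-α / 2)))
      (i3.const_mul _), integral_add' hs.integrable_normSq (hg.integrable_normSq.const_mul _),
    integral_const_mul, integral_const_mul, integral_sub' hg.integrable_normSq i2] at key
  rw [hs.hasSum_sq.tsum_eq, hg.hasSum_sq.tsum_eq, hg.hasSum_sq_lap.tsum_eq, totalFlux]
  linarith

end

/-- One step of the scheme on the half-space, with columns indexed by `ℕ`. -/
theorem energy_step {α β : ℝ} (hα : α ≤ 0) (hc : α ^ 2 + β ^ 2 ≤ 1 / 2) {x x' : ℕ → ℤ → ℝ}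
    (hx : Summable fun p : ℕ × ℤ => x p.1 p.2 ^ 2)
    (hx' : Summable fun p : ℕ × ℤ => x' p.1 p.2 ^ 2)
    (h0 : x' 0 = columnStep α β (x 0) (x 0) (x 1))
    (hs : ∀ j, x' (j + 1) = columnStep α β (x j) (x (j + 1)) (x (j + 2))) :
    ∑' p : ℕ × ℤ, x' p.1 p.2 ^ 2 + -α / 2 * ∑' k, x 0 k ^ 2
        + β ^ 2 * ((α ^ 2 + β ^ 2) / 16)
          * ∑' k, (x 0 (k + 1) - 2 * x 0 k + x 0 (k - 1)) ^ 2
      ≤ ∑' p : ℕ × ℤ, x p.1 p.2 ^ 2 := by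
  have hcol : ∀ j, ∃ f, HasHat f (x j) := fun j => exists_hasHat (hx.prod_factor j)
  choose f hf using hcol
  have hE := hx.prod
  have hE' := hx'.prod
  rw [hx.tsum_prod, hx'.tsum_prod]
  set b := -α / 2 * ∑' k, x 0 k ^ 2 + β ^ 2 * ((α ^ 2 + β ^ 2) / 16)
    * ∑' k, (x 0 (k + 1) - 2 * x 0 k + x 0 (k - 1)) ^ 2 with hb
  -- Fluxes telescope: only the outgoing flux of column `N` survives, the boundary terms coming from
  -- column 0.
  have hpart : ∀ N, ∑ j ∈ Finset.range (N + 1), ∑' k, x' j k ^ 2 + b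
      ≤ ∑ j ∈ Finset.range (N + 1), ∑' k, x j k ^ 2 - totalFlux α β (f N) (f (N + 1)) := by
    intro N
    induction N with
    | zero =>
      have := column_energy_boundary hα hc (hf 0) (hf 1)
      simp only [zero_add, Finset.range_one, Finset.sum_singleton, h0]
      linarith
    | succ N ih =>
      rw [Finset.sum_range_succ, Finset.sum_range_succ _ (N + 1), hs N]
      have := column_energy_interior hc (hf N) (hf (N + 1)) (hf (N + 2))
      linarith
  have hflux : Tendsto (fun N => totalFlux α β (f N) (f (N + 1))) atTop (𝓝 0) := by
    obtain ⟨C, hC⟩ := exists_abs_totalFlux_le α β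
    refine squeeze_zero_norm (fun N => hC (hf N) (hf (N + 1))) ?_
    have h1 := hE.tendsto_atTop_zero
    simpa using (h1.add (h1.comp (tendsto_add_atTop_nat 1))).const_mul C
  have l1 := ((hE'.hasSum.tendsto_sum_nat.comp (tendsto_add_atTop_nat 1)).add_const b)
  have l2 := (hE.hasSum.tendsto_sum_nat.comp (tendsto_add_atTop_nat 1)).sub hflux
  have := le_of_tendsto_of_tendsto' l1 l2 hpart
  linarith

end LaxWendroff

/-! ### Square summability and transfer to the half-space scheme. -/

namespace LaxWendroff
open Filter Topology

theorem memℓp_two_iff {ι : Type*} {f : ι → ℝ} : Memℓp f 2 ↔ Summable fun i => f i ^ 2 := by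
  rw [memℓp_gen_iff (by norm_num)]
  simp

theorem column_congr (u : J → ℝ) {i j : ℤ} (h : i = j) (hi : -1 ≤ i) (hj : -1 ≤ j) :
    column u i hi = column u j hj := by
  subst h; rfl

theorem memℓp_column {u : J → ℝ} (hu : Memℓp u 2) {σ : ℕ → ℤ} (hσ : σ.Injective)
    (hσ' : ∀ j, -1 ≤ σ j) {τ : ℤ → ℤ} (hτ : τ.Injective) :
    Memℓp (fun p : ℕ × ℤ => column u (σ p.1) (hσ' p.1) (τ p.2)) 2 := by
  rw [memℓp_two_iff] at hu ⊢
  refine hu.comp_injective (i := fun p : ℕ × ℤ => (⟨(σ p.1, τ p.2), hσ' p.1⟩ : J)) ?_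
  rintro ⟨j, k⟩ ⟨j', k'⟩ h
  simp only [Subtype.mk.injEq, Prod.mk.injEq] at h
  exact Prod.ext (hσ h.1) (hτ h.2)

theorem summable_interiorVal {u : J → ℝ} (hu : u ∈ H) :
    Summable fun p : ℕ × ℤ => interiorVal u p ^ 2 :=
  memℓp_two_iff.1 (memℓp_column hu.1 (σ := fun j => (j : ℤ)) (τ := fun k => k)
    Nat.cast_injective (fun _ => by omega) Function.injective_id)

theorem memℓp_lwUpdate (a b lam mu : ℝ) {u : J → ℝ} (hu : u ∈ H) :
    Memℓp (fun p : ℕ × ℤ => lwUpdate a b lam mu u p.1 p.2) 2 := by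
  have hc : ∀ m : ℤ, Function.Injective fun k : ℤ => k + m := add_left_injective
  have hc' : ∀ m : ℤ, Function.Injective fun k : ℤ => k - m := fun _ => sub_left_injective
  have hL : Function.Injective fun j : ℕ => (j : ℤ) - 1 := fun i j h => by simpa using h
  have hR : Function.Injective fun j : ℕ => (j : ℤ) + 1 := fun i j h => by simpa using h
  have hC : Function.Injective fun j : ℕ => (j : ℤ) := Nat.cast_injective
  have L {τ : ℤ → ℤ} (hτ : τ.Injective) := memℓp_column hu.1 hL (fun _ => by omega) hτ
  have C {τ : ℤ → ℤ} (hτ : τ.Injective) := memℓp_column hu.1 hC (fun _ => by omega) hτ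
  have R {τ : ℤ → ℤ} (hτ : τ.Injective) := memℓp_column hu.1 hR (fun _ => by omega) hτ
  have L0 := L Function.injective_id
  have C0 := C Function.injective_id
  have R0 := R Function.injective_id
  have Lp := L (hc 1)
  have Cp := C (hc 1)
  have Rp := R (hc 1)
  have Lm := L (hc' 1)
  have Cm := C (hc' 1)
  have Rm := R (hc' 1)
  exact (((((C0.sub ((R0.sub L0).const_mul _)).sub ((Cp.sub Cm).const_mul _)).add
    (((R0.sub (C0.const_mul _)).add L0).const_mul _)).add
    (((Cp.sub (C0.const_mul _)).add Cm).const_mul _)).add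
    ((((Rp.sub Rm).sub Lp).add Lm).const_mul _)).sub
    (((((((((Rp.sub (R0.const_mul _)).add Rm).sub (Cp.const_mul _)).add
      (C0.const_mul _)).sub (Cm.const_mul _)).add Lp).sub (L0.const_mul _)).add Lm).const_mul _)

/-- `J` is the disjoint union of the ghost column and the interior, and the ghost column copies
column 0. -/
theorem mem_H_of_summable {u : J → ℝ} (hi : Summable fun p : ℕ × ℤ => interiorVal u p ^ 2)
    (hg : ∀ k, ghostVal u k = bdryVal u k) : u ∈ H := by
  refine ⟨memℓp_two_iff.2 ?_, hg⟩
  have hghost : Summable fun k => ghostVal u k ^ 2 := by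
    simp only [hg]
    exact hi.prod_factor 0
  let e : ℤ ⊕ (ℕ × ℤ) ≃ J :=
    { toFun := Sum.elim (fun k => ⟨(-1, k), le_rfl⟩) (fun p => ⟨((p.1 : ℤ), p.2), by omega⟩)
      invFun := fun p => if 0 ≤ p.1.1 then Sum.inr (p.1.1.toNat, p.1.2) else Sum.inl p.1.2
      left_inv := by rintro (k | ⟨j, k⟩) <;> simp
      right_inv := by
        rintro ⟨⟨j, k⟩, hj⟩
        by_cases h : 0 ≤ j
        · simp [h]
        · have : j = -1 := by simp only at hj; omega
          subst this
          simp }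
  rw [← e.summable_iff]
  exact Summable.sum _ hghost hi

theorem lwUpdate_eq_columnStep (a b lam mu : ℝ) (u : J → ℝ) (j : ℕ) :
    lwUpdate a b lam mu u j = columnStep (lam * a) (mu * b) (column u ((j : ℤ) - 1) (by omega))
      (column u j (by omega)) (column u ((j : ℤ) + 1) (by omega)) := by
  ext k
  simp only [lwUpdate, columnStep]
  ring

theorem bdryVal_Lap2 (u : J → ℝ) (k : ℤ) :
    bdryVal (Lap2 u) k = bdryVal u (k + 1) - 2 * bdryVal u k + bdryVal u (k - 1) := by
  simp only [bdryVal, column, Lap2, D2plus, D2minus, add_sub_cancel_right]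
  ring

namespace IsNeumannScheme

variable {a b lam mu : ℝ} {u : ℕ → J → ℝ}

theorem mem_H (hu : IsNeumannScheme a b lam mu u) : ∀ n, u n ∈ H
  | 0 => hu.initial
  | n + 1 => by
    refine mem_H_of_summable ?_ (hu.boundary _)
    have := memℓp_two_iff.1 (memℓp_lwUpdate a b lam mu (hu.mem_H n))
    simpa only [← hu.step] using this

theorem energy_le (hu : IsNeumannScheme a b lam mu u) (ha : a < 0) (hlam : 0 < lam)
    (hCFL : (lam * a) ^ 2 + (mu * b) ^ 2 ≤ 1 / 2) (n : ℕ) :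
    normSqH (u (n + 1)) + lam * |a| / 2 * ∑' k : ℤ, bdryVal (u n) k ^ 2
        + (mu * b) ^ 2 * (((lam * a) ^ 2 + (mu * b) ^ 2) / 16)
          * ∑' k : ℤ, bdryVal (Lap2 (u n)) k ^ 2 ≤ normSqH (u n) := by
  have hstep : ∀ j : ℕ, (fun k => interiorVal (u (n + 1)) (j, k)) = columnStep (lam * a) (mu * b)
      (column (u n) ((j : ℤ) - 1) (by omega)) (column (u n) j (by omega))
      (column (u n) ((j : ℤ) + 1) (by omega)) := fun j => by
    rw [← lwUpdate_eq_columnStep]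
    exact funext (hu.step n j)
  have hsummable : ∀ m, Summable fun p : ℕ × ℤ => interiorVal (u m) (p.1, p.2) ^ 2 :=
    fun m => summable_interiorVal (hu.mem_H m)
  have key := energy_step (α := lam * a) (β := mu * b)
    (x := fun j k => interiorVal (u n) (j, k)) (x' := fun j k => interiorVal (u (n + 1)) (j, k))
    (mul_nonpos_of_nonneg_of_nonpos hlam.le ha.le) hCFL
    (hsummable n) (hsummable (n + 1)) ?_ ?_
  · rw [abs_of_neg ha, show lam * -a / 2 = -(lam * a) / 2 by ring]
    simp only [bdryVal_Lap2]
    exact key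
  · have h0 : column (u n) (((0 : ℕ) : ℤ) - 1) (by omega)
        = fun k => interiorVal (u n) (0, k) := by
      rw [column_congr (u n) (show ((0 : ℕ) : ℤ) - 1 = -1 by simp) (by omega) le_rfl]
      ext k
      exact hu.boundary n k
    rw [hstep 0, h0]
    rfl
  · intro j
    rw [hstep (j + 1)]
    have h1 : column (u n) (((j + 1 : ℕ) : ℤ) - 1) (by omega)
        = fun k => interiorVal (u n) (j, k) := by
      ext k
      simp [interiorVal, column]
    have h2 : column (u n) (((j + 1 : ℕ) : ℤ) + 1) (by omega)
        = fun k => interiorVal (u n) (j + 2, k) := by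
      ext k
      simp [interiorVal, column, add_assoc]
    rw [h1, h2]
    rfl

end IsNeumannScheme

theorem normSqH_nonneg (u : J → ℝ) : 0 ≤ normSqH u := tsum_nonneg fun _ => sq_nonneg _

end LaxWendroff

/-! ### Summation in time. -/

open LaxWendroff
theorem theorem1 (a b lam mu : ℝ) (ha : a < 0) (hlam : 0 < lam) (hmu : 0 < mu)
    (hCFL : (lam * a) ^ 2 + (mu * b) ^ 2 ≤ 1 / 2)
    (u : ℕ → J → ℝ) (hu : IsNeumannScheme a b lam mu u) :
    (∀ n : ℕ, u n ∈ H) ∧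
    (∀ n : ℕ,
      normSqH (u (n + 1)) - normSqH (u n)
        + lam * |a| / 2 * ∑' k : ℤ, bdryVal (u n) k ^ 2
        + (mu * b) ^ 2 * (((lam * a) ^ 2 + (mu * b) ^ 2) / 16)
          * ∑' k : ℤ, bdryVal (Lap2 (u n)) k ^ 2 ≤ 0) ∧
    BddAbove (Set.range fun n : ℕ => normSqH (u n)) ∧
    Summable (fun p : ℕ × ℤ => bdryVal (u p.1) p.2 ^ 2) ∧
    Summable (fun p : ℕ × ℤ => bdryVal (Lap2 (u p.1)) p.2 ^ 2) ∧
    (⨆ n : ℕ, normSqH (u n))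
        + lam * |a| / 2 * ∑' n : ℕ, ∑' k : ℤ, bdryVal (u n) k ^ 2
        + (mu * b) ^ 2 * (((lam * a) ^ 2 + (mu * b) ^ 2) / 16)
          * ∑' n : ℕ, ∑' k : ℤ, bdryVal (Lap2 (u n)) k ^ 2
      ≤ 2 * normSqH (u 0) := by
  have hE := hu.energy_le ha hlam hCFL
  have hA : 0 < lam * |a| / 2 := by have := abs_pos.2 ha.ne; positivity
  have hB : 0 ≤ (mu * b) ^ 2 * (((lam * a) ^ 2 + (mu * b) ^ 2) / 16) := by positivity
  set A := lam * |a| / 2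
  set B := (mu * b) ^ 2 * (((lam * a) ^ 2 + (mu * b) ^ 2) / 16)
  have hS : ∀ n, 0 ≤ ∑' k : ℤ, bdryVal (u n) k ^ 2 := fun n => tsum_nonneg fun _ => sq_nonneg _
  have hT : ∀ n, 0 ≤ ∑' k : ℤ, bdryVal (Lap2 (u n)) k ^ 2 :=
    fun n => tsum_nonneg fun _ => sq_nonneg _
  have hsum : ∀ N, ∑ n ∈ Finset.range N, (A * ∑' k : ℤ, bdryVal (u n) k ^ 2
      + B * ∑' k : ℤ, bdryVal (Lap2 (u n)) k ^ 2) + normSqH (u N) ≤ normSqH (u 0) := by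
    intro N
    induction N with
    | zero => simp
    | succ N ih => rw [Finset.sum_range_succ]; linarith [hE N]
  have hdec : ∀ n, normSqH (u n) ≤ normSqH (u 0) := fun n => by
    have : 0 ≤ ∑ n ∈ Finset.range n, (A * ∑' k : ℤ, bdryVal (u n) k ^ 2
        + B * ∑' k : ℤ, bdryVal (Lap2 (u n)) k ^ 2) :=
      Finset.sum_nonneg fun n _ => add_nonneg (mul_nonneg hA.le (hS n)) (mul_nonneg hB (hT n))
    linarith [hsum n]
  have hsumS : Summable fun n => ∑' k : ℤ, bdryVal (u n) k ^ 2 := by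
    refine summable_of_sum_range_le (c := normSqH (u 0) / A) hS fun N => ?_
    rw [le_div_iff₀' hA, Finset.mul_sum]
    refine le_trans ?_ (hsum N)
    refine (Finset.sum_le_sum fun n _ => ?_).trans
      (le_add_of_nonneg_right (normSqH_nonneg _))
    exact le_add_of_nonneg_right (mul_nonneg hB (hT n))
  have hS2 : Summable fun p : ℕ × ℤ => bdryVal (u p.1) p.2 ^ 2 :=
    (summable_prod_of_nonneg fun _ => sq_nonneg _).2
      ⟨fun n => (summable_interiorVal (hu.mem_H n)).prod_factor 0, hsumS⟩
  -- `B` vanishes when `b = 0`, so the energy bound cannot give this; `Δ₂` is instead a combination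
  -- of shifts of the square summable trace.
  have hT2 : Summable fun p : ℕ × ℤ => bdryVal (Lap2 (u p.1)) p.2 ^ 2 := by
    rw [← memℓp_two_iff] at hS2 ⊢
    have hshift : ∀ m : ℤ, Memℓp (fun p : ℕ × ℤ => bdryVal (u p.1) (p.2 + m)) 2 := fun m => by
      rw [memℓp_two_iff] at hS2 ⊢
      refine hS2.comp_injective (i := fun p : ℕ × ℤ => (p.1, p.2 + m)) ?_
      rintro ⟨n, k⟩ ⟨n', k'⟩ h
      simpa using h
    simp only [bdryVal_Lap2]
    exact ((hshift 1).sub (hS2.const_mul 2)).add (hshift (-1))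
  refine ⟨hu.mem_H, fun n => by linarith [hE n], ⟨_, Set.forall_mem_range.2 hdec⟩, hS2, hT2, ?_⟩
  have hsup : (⨆ n : ℕ, normSqH (u n)) ≤ normSqH (u 0) := ciSup_le hdec
  have hlim := ((hsumS.hasSum.mul_left A).add (hT2.prod.hasSum.mul_left B)).tendsto_sum_nat
  have hle := le_of_tendsto' hlim fun N =>
    (le_add_of_nonneg_right (normSqH_nonneg (u N))).trans (hsum N)
  linarith
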